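/- For sets $X, Y \subseteq \mathbb{N}$ write $X =^* Y$ if the symmetric difference $X \triangle Y$ is finite, and write $\overline{X} = \mathbb{N} \setminus X$. A set has c.e. degree if it is Turing equivalent to some computably enumerable (c.e.) set. A separator of $A$ and $B$ is a set $X$ with $A \subseteq X$ and $B \subseteq \overline{X}$. Two c.e. sets $A, B$ form a super-maximal pair if $A \cap B = \emptyset$, $\mathbb{N} \setminus (A \cup B)$ is infinite, and every separator $X$ of $A$ and $B$ of c.e. degree satisfies $X =^* A$ or $\overline{X} =^* B$. Theorem. Let $A$ and $B$ be disjoint c.e. sets such that $\mathbb{N} \setminus (A \cup B)$ is infinite. Then there is a separator $X$ of $A$ and $B$ of c.e. degree such that $X \neq^* A$ and $\overline{X} \neq^* B$. Consequently, super-maximal pairs do not exist. -/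

import Mathlib

/-- `A ⊆ ℕ` is computably enumerable. -/
def IsCE (A : Set ℕ) : Prop := REPred fun n : ℕ => n ∈ A

open Classical in
/-- The characteristic function of `X ⊆ ℕ`, as a (total) element of `ℕ →. ℕ`. -/
noncomputable def charFn (X : Set ℕ) : ℕ →. ℕ :=
  fun n => Part.some (if n ∈ X then 1 else 0)

/-- `X` has c.e. Turing degree: it is Turing equivalent to some c.e. set. -/
def HasCEDegree (X : Set ℕ) : Prop :=
  ∃ W : Set ℕ, IsCE W ∧ TuringEquivalent (charFn X) (charFn W)

/-- `X =* Y`: the two sets differ on only finitely many elements. -/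
def EqStar (X Y : Set ℕ) : Prop := (symmDiff X Y).Finite

/-- `X` separates `A` from `B`: `A ⊆ X` and `B` is contained in the complement of `X`. -/
def IsSeparator (A B X : Set ℕ) : Prop := A ⊆ X ∧ B ⊆ Xᶜ

/-- Super-maximal pairs of sets. -/
structure IsSuperMaximalPair (A B : Set ℕ) : Prop where
  ce_left : IsCE A
  ce_right : IsCE B
  disjoint : A ∩ B = ∅
  infinite_compl : (A ∪ B)ᶜ.Infinite
  eqStar_of_separator : ∀ X : Set ℕ, HasCEDegree X → IsSeparator A B X →
    EqStar X A ∨ EqStar Xᶜ B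

/-!
Let four candidate separators `X₀, …, X₃` run through the joint enumeration of `A` and `B`. Each
number carries a label in `{0, 1}⁴` listing the candidates that contain it; as long as the number
has not been enumerated, its label has exactly two ones. The invariant is that the labels of
consecutive numbers outside `A ∪ B` are neither equal nor complementary. When a number `k` enters
`A` (or `B`), its label becomes constantly `1` (or `0`), and if this makes two labels adjacent that
violate the invariant, the two candidates that were wrong about `k` are exchanged beyond `k`.

So the value of `Xᵢ` at `n` changes only when `Xᵢ` is wrong about some `k ≤ n`. Hence `Xᵢ` can be
used to find a stage after which its approximation up to `n` is final, and `Xᵢ` has the degree of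
the c.e. set of changes. If every candidate were constant on almost all numbers outside `A ∪ B`,
the labels of consecutive numbers would eventually be equal, against the invariant. So some `Xᵢ`
contains infinitely many of these numbers and also omits infinitely many.
-/

section OracleComputability

open Encodable

variable {α β γ σ : Type*} [Primcodable α] [Primcodable β] [Primcodable γ] [Primcodable σ]
  {O : Set (ℕ →. ℕ)}

theorem computableIn_comp {f : β → σ} {g : α → β} (hf : ComputableIn O f)
    (hg : ComputableIn O g) : ComputableIn O fun a => f (g a) :=
  (Nat.RecursiveIn.comp hf hg).of_eq fun n => by cases decode (α := α) n <;> simp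

theorem computableIn_pair {f : α → β} {g : α → σ} (hf : ComputableIn O f)
    (hg : ComputableIn O g) : ComputableIn O fun a => (f a, g a) :=
  (Nat.RecursiveIn.pair hf hg).of_eq fun n => by cases decode (α := α) n <;> simp [Seq.seq]

theorem computableIn₂_comp {f : β → γ → σ} {g : α → β} {h : α → γ} (hf : ComputableIn₂ O f)
    (hg : ComputableIn O g) (hh : ComputableIn O h) : ComputableIn O fun a => f (g a) (h a) :=
  computableIn_comp hf (computableIn_pair hg hh)

theorem computableIn₂_nat_rec {f : α → σ} {g : α → ℕ × σ → σ} (hf : ComputableIn O f)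
    (hg : ComputableIn₂ O g) :
    ComputableIn₂ O fun (a : α) (n : ℕ) =>
      n.rec (motive := fun _ => σ) (f a) fun y s => g a (y, s) := by
  refine (Nat.RecursiveIn.prec hf hg).of_eq fun m => ?_
  obtain ⟨⟨m, n⟩, rfl⟩ := Nat.pairEquiv.surjective m
  cases h : decode (α := α) m <;> induction n <;> simp_all

theorem computableIn₂_forall_lt {p : α → ℕ → Bool} (hp : ComputableIn₂ O p) :
    ComputableIn₂ O fun a n => decide (∀ k < n, p a k = true) := by
  have hstep : ComputableIn₂ O fun (a : α) (q : ℕ × Bool) => q.2 && p a q.1 :=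
    computableIn₂_comp Primrec.and.computableIn₂
      (computableIn_comp .snd .snd)
      (computableIn₂_comp hp .fst (computableIn_comp .fst .snd))
  refine (computableIn₂_nat_rec (.const true) hstep).of_eq fun ⟨a, n⟩ => congrArg Part.some ?_
  induction n with
  | zero => simp
  | succ n ih =>
    dsimp only at ih ⊢
    simp only [ih, Nat.forall_lt_succ_right, Bool.decide_and, Bool.decide_eq_true]

theorem computableIn_find {p : α → ℕ → Bool} (hp : ComputableIn₂ O p)
    (hex : ∀ a, ∃ n, p a n = true) : ComputableIn O fun a => Nat.find (hex a) := by
  have hnot : ComputableIn O fun q : α × ℕ => (!p q.1 q.2).toNat :=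
    computableIn_comp (f := fun b : Bool => (!b).toNat) (g := fun q : α × ℕ => p q.1 q.2)
      (Primrec.dom_finite _).computableIn hp
  refine (Nat.RecursiveIn.rfind hnot).of_eq fun m => ?_
  cases h : decode (α := α) m with
  | none => simpa using Nat.rfind_zero_none _ (by simp [h])
  | some a =>
    have hfind : Nat.find (hex a) ∈ Nat.rfind fun n => Part.some (p a n) :=
      Nat.mem_rfind.2 ⟨by simp [Nat.find_spec (hex a)],
        fun hm => by simpa using Nat.find_min (hex a) hm⟩
    simpa [h] using Part.eq_some_iff.2 hfind

end OracleComputability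

section BoundedQuantifier

variable {α : Type*} [Primcodable α] {R : α → ℕ → Prop} {f : α → ℕ}

theorem primrecPred_exists_lt (hR : PrimrecRel R) (hf : Primrec f) :
    PrimrecPred fun a => ∃ n < f a, R a n :=
  (hR.swap.exists_mem_list.comp (Primrec.list_range.comp hf) .id).of_eq fun a => by
    simp [Function.swap]

end BoundedQuantifier

section TuringDegree

open Filter

theorem charFn_eq (X : Set ℕ) [DecidablePred (· ∈ X)] :
    charFn X = fun n => Part.some (if n ∈ X then 1 else 0) := by
  funext n
  rw [charFn]
  congr

theorem computableIn_charFn (X : Set ℕ) [DecidablePred (· ∈ X)] :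
    ComputableIn {charFn X} fun n => decide (n ∈ X) := by
  have hX : ComputableIn {charFn X} fun n => if n ∈ X then 1 else 0 := by
    rw [charFn_eq]
    exact RecursiveIn.oracle _ rfl
  have hone : Primrec fun k : ℕ => decide (k = 1) := Primrec.eq.decide.comp .id (.const 1)
  exact (computableIn_comp hone.computableIn hX).of_eq fun n => by
    by_cases hn : n ∈ X <;> simp [hn]

theorem charFn_turingReducible {X : Set ℕ} [DecidablePred (· ∈ X)] {O : ℕ →. ℕ}
    (h : ComputableIn {O} fun n => decide (n ∈ X)) : TuringReducible (charFn X) O :=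
  (computableIn_comp (Primrec.dom_finite Bool.toNat).computableIn h).of_eq fun n => by
    by_cases hn : n ∈ X <;> simp [charFn_eq, hn]

/-- The approximation `f` at `n` has at stage `t` left the value it had at the earlier stage `s`. -/
abbrev ChangesAt (f : ℕ → ℕ → Bool) (s n t : ℕ) : Prop := s ≤ t ∧ f t n ≠ f s n

/-- Codes of the pairs `(s, n)` such that the approximation `f` changes its value at `n` after
stage `s`. It has the degree of the limit of `f` when `f` never leaves a correct initial segment. -/
def changeSet (f : ℕ → ℕ → Bool) : Set ℕ :=
  {z | ∃ t, ChangesAt f z.unpair.1 z.unpair.2 t}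

variable {f : ℕ → ℕ → Bool} {X : Set ℕ} [DecidablePred (· ∈ X)]

theorem computable_changesAt (hf : Computable₂ f) :
    Computable₂ fun z t : ℕ => decide (ChangesAt f z.unpair.1 z.unpair.2 t) := by
  have hs : Computable fun q : ℕ × ℕ => q.1.unpair.1 := Computable.fst.comp (.comp .unpair .fst)
  have hn : Computable fun q : ℕ × ℕ => q.1.unpair.2 := Computable.snd.comp (.comp .unpair .fst)
  have hle : Computable fun q : ℕ × ℕ => decide (q.1.unpair.1 ≤ q.2) :=
    Primrec.nat_le.decide.to_comp.comp hs .snd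
  have hne : Computable fun q : ℕ × ℕ =>
      decide (f q.2 q.1.unpair.2 ≠ f q.1.unpair.1 q.1.unpair.2) :=
    Primrec.eq.not.decide.to_comp.comp (hf.comp .snd hn) (hf.comp hs hn)
  exact (Primrec.and.to_comp.comp hle hne).of_eq fun q => (Bool.decide_and _ _).symm

theorem isCE_changeSet (hf : Computable₂ f) : IsCE (changeSet f) :=
  (Partrec.rfind (computable_changesAt hf).partrec₂).dom_re.of_eq fun z => by
    simp [Nat.rfind_dom, changeSet]

theorem eq_of_pair_notMem_changeSet {s n : ℕ} {b : Bool} (hlim : ∀ᶠ t in atTop, f t n = b)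
    (hs : Nat.pair s n ∉ changeSet f) : f s n = b := by
  obtain ⟨t, hst, ht⟩ := ((eventually_ge_atTop s).and hlim).exists
  by_contra hne
  exact hs ⟨t, by simp [ChangesAt, hst, ht, Ne.symm hne]⟩

theorem exists_pair_notMem_changeSet {n : ℕ} {b : Bool} (hlim : ∀ᶠ t in atTop, f t n = b) :
    ∃ s, Nat.pair s n ∉ changeSet f := by
  obtain ⟨s, hs⟩ := eventually_atTop.1 hlim
  refine ⟨s, fun ⟨t, ht, hne⟩ => hne ?_⟩
  simp only [Nat.unpair_pair] at ht ⊢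
  rw [hs t ht, hs s le_rfl]

theorem turingReducible_changeSet (hf : Computable₂ f)
    (hlim : ∀ n, ∀ᶠ s in atTop, f s n = decide (n ∈ X)) :
    TuringReducible (charFn X) (charFn (changeSet f)) := by
  classical
  have hstable : ComputableIn₂ {charFn (changeSet f)} fun n s : ℕ =>
      !decide (Nat.pair s n ∈ changeSet f) :=
    computableIn_comp Primrec.not.computableIn (computableIn_comp (computableIn_charFn _)
      (computableIn₂_comp Primrec₂.natPair.computableIn₂ .snd .fst))
  have hex : ∀ n, ∃ s, (!decide (Nat.pair s n ∈ changeSet f)) = true := fun n =>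
    (exists_pair_notMem_changeSet (hlim n)).imp fun s hs => by simpa using hs
  refine charFn_turingReducible ((computableIn₂_comp (f := f) hf.computableIn
    (computableIn_find hstable hex) .id).of_eq fun n => congrArg Part.some ?_)
  exact eq_of_pair_notMem_changeSet (hlim n) (by simpa using Nat.find_spec (hex n))

theorem eq_of_forall_le_eq (hstay : ∀ s n, (∀ k ≤ n, f s k = decide (k ∈ X)) →
      f (s + 1) n = decide (n ∈ X)) {s t n : ℕ} (hst : s ≤ t)
    (hs : ∀ k ≤ n, f s k = decide (k ∈ X)) : f t n = decide (n ∈ X) := by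
  suffices ∀ k ≤ n, f t k = decide (k ∈ X) from this n le_rfl
  induction t, hst using Nat.le_induction with
  | base => exact hs
  | succ t _ ih => exact fun k hk => hstay t k fun j hj => ih j (hj.trans hk)

/-- If stage `u` is the first one at which `f` has changed at `n` or is correct up to `n`,
then a change after `s` that is not visible at `u` could only happen later, which correctness up to
`n` excludes. -/
theorem exists_changesAt_iff_of_isLeast
    (hstay : ∀ s n, (∀ k ≤ n, f s k = decide (k ∈ X)) → f (s + 1) n = decide (n ∈ X)) {s n u : ℕ}
    (hu : IsLeast {t | ChangesAt f s n t ∨ ∀ k ≤ n, f t k = decide (k ∈ X)} u) :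
    (∃ t, ChangesAt f s n t) ↔ ChangesAt f s n u := by
  refine ⟨fun ⟨t, ht⟩ => hu.1.elim id fun hcorrect => ?_, fun h => ⟨u, h⟩⟩
  have hstays {r : ℕ} (hr : u ≤ r) : f r n = decide (n ∈ X) := eq_of_forall_le_eq hstay hr hcorrect
  have htu : f t n = f u n := (hstays (hu.2 (Or.inl ht))).trans (hstays le_rfl).symm
  rcases le_total s u with hsu | hus
  · exact ⟨hsu, htu ▸ ht.2⟩
  · exact absurd (htu.trans ((hstays le_rfl).trans (hstays hus).symm)) ht.2

theorem changeSet_turingReducible (hf : Computable₂ f)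
    (hlim : ∀ n, ∀ᶠ s in atTop, f s n = decide (n ∈ X))
    (hstay : ∀ s n, (∀ k ≤ n, f s k = decide (k ∈ X)) → f (s + 1) n = decide (n ∈ X)) :
    TuringReducible (charFn (changeSet f)) (charFn X) := by
  classical
  let change (z t : ℕ) : Bool := decide (ChangesAt f z.unpair.1 z.unpair.2 t)
  let correct (t n : ℕ) : Bool := decide (∀ k < n, decide (f t k = decide (k ∈ X)) = true)
  have hchange : ComputableIn₂ {charFn X} change := (computable_changesAt hf).computableIn
  have hcorrect : ComputableIn₂ {charFn X} correct :=
    computableIn₂_forall_lt (computableIn₂_comp Primrec.eq.decide.computableIn₂ hf.computableIn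
      (computableIn_comp (computableIn_charFn X) .snd))
  have hbound : ComputableIn {charFn X} fun q : ℕ × ℕ => q.1.unpair.2 + 1 :=
    computableIn_comp .succ (computableIn_comp .snd (computableIn_comp .unpair .fst))
  have hsearch : ComputableIn₂ {charFn X} fun z t => change z t || correct t (z.unpair.2 + 1) :=
    computableIn₂_comp Primrec.or.computableIn₂ hchange (computableIn₂_comp hcorrect .snd hbound)
  have hiff (z t : ℕ) : (change z t || correct t (z.unpair.2 + 1)) = true ↔
      ChangesAt f z.unpair.1 z.unpair.2 t ∨ ∀ k ≤ z.unpair.2, f t k = decide (k ∈ X) := by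
    simp [change, correct]
  have hex (z : ℕ) : ∃ t, (change z t || correct t (z.unpair.2 + 1)) = true :=
    ((eventually_all_finite (Set.finite_le_nat z.unpair.2)).2 fun k _ => hlim k).exists.imp
      fun t ht => (hiff z t).2 (Or.inr ht)
  refine charFn_turingReducible ((computableIn₂_comp hchange .id
    (computableIn_find hsearch hex)).of_eq fun z => congrArg Part.some ?_)
  exact decide_eq_decide.2 (exists_changesAt_iff_of_isLeast hstay
    ⟨(hiff z _).1 (Nat.find_spec (hex z)),
      fun t ht => Nat.find_min' (hex z) ((hiff z t).2 ht)⟩).symm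

theorem hasCEDegree_of_approx (hf : Computable₂ f)
    (hlim : ∀ n, ∀ᶠ s in atTop, f s n = decide (n ∈ X))
    (hstay : ∀ s n, (∀ k ≤ n, f s k = decide (k ∈ X)) → f (s + 1) n = decide (n ∈ X)) :
    HasCEDegree X :=
  ⟨changeSet f, isCE_changeSet hf, turingReducible_changeSet hf hlim,
    changeSet_turingReducible hf hlim hstay⟩

end TuringDegree

section Enumeration

open Nat.Partrec

theorem exists_primrec_enumeration {α : Type*} [Primcodable α] {p : α → Prop} (hp : REPred p) :
    ∃ ev : ℕ → Option α, Primrec ev ∧ (∀ s a, ev s = some a → Encodable.encode a ≤ s) ∧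
      ∀ a, p a ↔ ∃ s, ev s = some a := by
  obtain ⟨c, hc⟩ := Code.exists_code.1 (Partrec.bind_decode₂_iff.1 hp)
  have hmem (a : α) : p a ↔ ∃ k x, x ∈ c.evaln k (Encodable.encode a) := by
    rw [exists_comm]
    simp only [← Code.evaln_complete, hc]
    simp
  let halted (s : ℕ) : Bool := (c.evaln s.unpair.2 s.unpair.1).isSome
  have hhalted : Primrec halted := Primrec.option_isSome.comp (Code.primrec_evaln.comp
    (((Primrec.snd.comp .unpair).pair (.const c)).pair (Primrec.fst.comp .unpair)))
  let ev (s : ℕ) : Option α := bif halted s then Encodable.decode₂ α s.unpair.1 else none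
  have hev {s : ℕ} {a : α} : ev s = some a ↔ halted s = true ∧ Encodable.encode a = s.unpair.1 := by
    cases h : halted s <;> simp [ev, h, Encodable.decode₂_eq_some]
  refine ⟨ev, .cond hhalted (Primrec.decode₂.comp (Primrec.fst.comp .unpair)) (.const none),
    fun s a h => (hev.1 h).2 ▸ Nat.unpair_left_le s, fun a => (hmem a).trans ⟨?_, ?_⟩⟩
  · rintro ⟨k, hk⟩
    exact ⟨Nat.pair (Encodable.encode a) k,
      hev.2 (by simpa [halted, Option.isSome_iff_exists] using hk)⟩
  · rintro ⟨s, hs⟩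
    obtain ⟨hhalt, hcode⟩ := hev.1 hs
    exact ⟨s.unpair.2, hcode ▸ Option.isSome_iff_exists.1 hhalt⟩

theorem rePred_cond_mem {A B : Set ℕ} (hA : IsCE A) (hB : IsCE B) :
    REPred fun q : ℕ × Bool => q.1 ∈ cond q.2 A B := by
  refine (Partrec.cond .snd (hA.comp .fst) (hB.comp .fst)).of_eq fun q => ?_
  rcases q with ⟨n, _ | _⟩ <;> simp

end Enumeration

/-- The label of a number records its membership in the four candidate separators. -/
abbrev Label := Fin 4 → Bool

namespace Label

/-- A label is live if its number lies in exactly two of the four candidates; the label of a number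
enumerated into one of the given sets is constant, hence not live. -/
def Live (v : Label) : Prop := (Finset.univ.filter fun i => v i = true).card = 2

instance : DecidablePred Live := fun v => by unfold Live; infer_instance

/-- Two labels are compatible if they are neither equal nor complementary. -/
def Compat (v w : Label) : Prop := w ≠ v ∧ w ≠ fun i => !v i

instance : DecidableRel Compat := fun v w => by unfold Compat; infer_instance

/-- For live `v`, the transposition of the two indices at which `v` differs from `b`. -/
def turn (v : Label) (b : Bool) : Equiv.Perm (Fin 4) :=
  ((List.finRange 4).filter fun i => v i ≠ b).formPerm

theorem turn_apply_of_eq {v : Label} {b : Bool} {i : Fin 4} (h : v i = b) : turn v b i = i :=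
  List.formPerm_apply_of_notMem (by simp [h])

theorem not_live_const (b : Bool) : ¬ Live fun _ => b := by
  revert b
  decide

theorem live_comp (v : Label) (π : Equiv.Perm (Fin 4)) : Live (v ∘ π) ↔ Live v := by
  have hcard : (Finset.univ.filter fun i => v (π i) = true).card =
      (Finset.univ.filter fun i => v i = true).card :=
    Finset.card_equiv π fun i => by simp
  simp only [Live, Function.comp_apply, hcard]

theorem Compat.comp {v w : Label} (h : Compat v w) (π : Equiv.Perm (Fin 4)) :
    Compat (v ∘ π) (w ∘ π) :=
  ⟨fun heq => h.1 (π.surjective.injective_comp_right heq),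
    fun heq => h.2 (π.surjective.injective_comp_right heq)⟩

/-- Here `u = w` or `u = ¬w`, so `w` takes both values on the exchanged pair as well as on the
fixed pair: exchanging the former makes `w` neither equal nor complementary to `u`. -/
theorem Compat.comp_turn {u v w : Label} (hu : Live u) (hv : Live v) (hw : Live w)
    (huv : Compat u v) (hvw : Compat v w) (huw : ¬ Compat u w) (b : Bool) :
    Compat u (w ∘ turn v b) := by
  revert u v w b
  decide +kernel

end Label

/-- An assignment of a label to every number. -/
abbrev Labelling := ℕ → Label

namespace Labelling

open Label

section Kill

/-- `m < n` are live positions without live positions between them. -/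
structure Consecutive (f : Labelling) (m n : ℕ) : Prop where
  lt : m < n
  live_left : Live (f m)
  live_right : Live (f n)
  not_live_of_mem_Ioo : ∀ j ∈ Set.Ioo m n, ¬ Live (f j)

/-- Consecutive live labels are compatible. -/
def Good (f : Labelling) : Prop := ∀ ⦃m n⦄, Consecutive f m n → Compat (f m) (f n)

/-- `m` is the last live position before `k`, and `n` is the first live position after `k`. -/
structure Straddles (f : Labelling) (k m n : ℕ) : Prop where
  mem_Ioo : k ∈ Set.Ioo m n
  live_left : Live (f m)
  live_right : Live (f n)
  eq_of_live_of_mem_Ioo : ∀ j ∈ Set.Ioo m n, Live (f j) → j = k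

/-- Position `k` separates two incompatible live labels, which would become consecutive if `k`
ceased to be live. -/
def Clash (f : Labelling) (k : ℕ) : Prop := ∃ m n, Straddles f k m n ∧ ¬ Compat (f m) (f n)

open Classical in
/-- The permutation of the four candidates that is applied beyond `k` when `k` gets the constant
label `b`. -/
noncomputable def repair (f : Labelling) (k : ℕ) (b : Bool) : Equiv.Perm (Fin 4) :=
  if Clash f k then turn (f k) b else 1

/-- Give a live position `k` the constant label `b` and repair the labels beyond `k`. -/
noncomputable def kill (f : Labelling) (k : ℕ) (b : Bool) : Labelling := fun n =>
  if n < k ∨ ¬ Live (f k) then f n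
  else if n = k then fun _ => b
  else f n ∘ repair f k b

variable {f g : Labelling} {k m n : ℕ} {b : Bool}

theorem kill_of_lt (h : n < k) : kill f k b n = f n := if_pos (Or.inl h)

theorem kill_of_not_live (h : ¬ Live (f k)) : kill f k b = f := funext fun _ => if_pos (Or.inr h)

theorem kill_self (h : Live (f k)) : kill f k b k = fun _ => b := by
  simp [kill, h]

theorem kill_of_gt (h : Live (f k)) (hn : k < n) : kill f k b n = f n ∘ repair f k b := by
  simp [kill, h, hn.not_gt, hn.ne']

theorem live_kill_iff : Live (kill f k b n) ↔ n ≠ k ∧ Live (f n) := by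
  by_cases hk : Live (f k)
  · rcases lt_trichotomy n k with hn | rfl | hn
    · simp [kill_of_lt hn, hn.ne]
    · simp [kill_self hk, not_live_const]
    · simp [kill_of_gt hk hn, live_comp, hn.ne']
  · rw [kill_of_not_live hk]
    exact ⟨fun h => ⟨fun hnk => hk (hnk ▸ h), h⟩, And.right⟩

theorem kill_eq_const {c : Bool} (h : f n = fun _ => c) : kill f k b n = fun _ => c := by
  by_cases hk : Live (f k)
  · rcases lt_trichotomy n k with hn | rfl | hn
    · rw [kill_of_lt hn, h]
    · exact absurd (h ▸ hk) (not_live_const c)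
    · rw [kill_of_gt hk hn, h]
      rfl
  · rw [kill_of_not_live hk, h]

theorem repair_apply_of_eq {i : Fin 4} (h : f k i = b) : repair f k b i = i := by
  rw [repair]
  split_ifs
  · exact turn_apply_of_eq h
  · rfl

theorem of_kill_apply_ne {i : Fin 4} (h : kill f k b n i ≠ f n i) :
    k ≤ n ∧ Live (f k) ∧ f k i ≠ b := by
  have hk : Live (f k) := by
    by_contra hk
    exact h (by rw [kill_of_not_live hk])
  rcases lt_trichotomy n k with hn | rfl | hn
  · exact absurd (congrFun (kill_of_lt hn) i) h
  · exact ⟨le_rfl, hk, fun hi => h (by rw [kill_self hk, hi])⟩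
  · refine ⟨hn.le, hk, fun hi => h ?_⟩
    rw [kill_of_gt hk hn, Function.comp_apply, repair_apply_of_eq hi]

theorem Straddles.unique {m' n' : ℕ} (h : Straddles f k m n) (h' : Straddles f k m' n') :
    m = m' ∧ n = n' := by
  obtain ⟨⟨hmk, hkn⟩, hm, hn, hbetween⟩ := h
  obtain ⟨⟨hmk', hkn'⟩, hm', hn', hbetween'⟩ := h'
  refine ⟨?_, ?_⟩
  · rcases lt_trichotomy m m' with hlt | heq | hgt
    · exact absurd (hbetween m' ⟨hlt, hmk'.trans hkn⟩ hm') hmk'.ne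
    · exact heq
    · exact absurd (hbetween' m ⟨hgt, hmk.trans hkn'⟩ hm) hmk.ne
  · rcases lt_trichotomy n n' with hlt | heq | hgt
    · exact absurd (hbetween' n ⟨hmk'.trans hkn, hlt⟩ hn) hkn.ne'
    · exact heq
    · exact absurd (hbetween n' ⟨hmk.trans hkn', hgt⟩ hn') hkn'.ne'

theorem Good.compat_comp_repair (hf : Good f) (hk : Live (f k)) (h : Straddles f k m n)
    (b : Bool) : Compat (f m) (f n ∘ repair f k b) := by
  rw [repair]
  split_ifs with hclash
  · obtain ⟨m', n', h', hincompat⟩ := hclash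
    obtain ⟨rfl, rfl⟩ := h.unique h'
    have hmk : Consecutive f m k := ⟨h.mem_Ioo.1, h.live_left, hk, fun j hj hlive =>
      hj.2.ne (h.eq_of_live_of_mem_Ioo j ⟨hj.1, hj.2.trans h.mem_Ioo.2⟩ hlive)⟩
    have hkn : Consecutive f k n := ⟨h.mem_Ioo.2, hk, h.live_right, fun j hj hlive =>
      hj.1.ne' (h.eq_of_live_of_mem_Ioo j ⟨h.mem_Ioo.1.trans hj.1, hj.2⟩ hlive)⟩
    exact (hf hmk).comp_turn h.live_left hk h.live_right (hf hkn) hincompat b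
  · by_contra hincompat
    exact hclash ⟨m, n, h, hincompat⟩

theorem Good.kill (hf : Good f) (k : ℕ) (b : Bool) : Good (kill f k b) := by
  by_cases hk : Live (f k)
  swap
  · rwa [kill_of_not_live hk]
  rintro m n ⟨hmn, hm, hn, hbetween⟩
  obtain ⟨hmk, hm⟩ := live_kill_iff.1 hm
  obtain ⟨hnk, hn⟩ := live_kill_iff.1 hn
  have heq (j) (hj : j ∈ Set.Ioo m n) (hlive : Live (f j)) : j = k := by
    by_contra hjk
    exact hbetween j hj (live_kill_iff.2 ⟨hjk, hlive⟩)
  rcases hmk.lt_or_gt with hmk | hkm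
  · rcases hnk.lt_or_gt with hnk | hkn
    · rw [kill_of_lt hmk, kill_of_lt hnk]
      exact hf ⟨hmn, hm, hn, fun j hj hlive => (hj.2.trans hnk).ne (heq j hj hlive)⟩
    · rw [kill_of_lt hmk, kill_of_gt hk hkn]
      exact hf.compat_comp_repair hk ⟨⟨hmk, hkn⟩, hm, hn, heq⟩ b
  · rw [kill_of_gt hk hkm, kill_of_gt hk (hkm.trans hmn)]
    exact (hf ⟨hmn, hm, hn, fun j hj hlive => (hkm.trans hj.1).ne' (heq j hj hlive)⟩).comp _

theorem Clash.of_eqOn {N j : ℕ} (h : Clash f k) (hfg : ∀ i < N, f i = g i) (hj : Live (f j))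
    (hkj : k < j) (hjN : j < N) : Clash g k := by
  obtain ⟨m, n, ⟨⟨hmk, hkn⟩, hm, hn, hbetween⟩, hincompat⟩ := h
  have hnN : n < N := by
    by_contra hn
    exact hkj.ne' (hbetween j ⟨hmk.trans hkj, by omega⟩ hj)
  rw [hfg m (by omega)] at hm hincompat
  rw [hfg n hnN] at hn hincompat
  refine ⟨m, n, ⟨⟨hmk, hkn⟩, hm, hn, fun i hi hlive => ?_⟩, hincompat⟩
  exact hbetween i hi (by rwa [hfg i (hi.2.trans hnN)])

/-- Whether there is a clash at `k` is decided by the labels up to any live position beyond `k`. -/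
theorem kill_congr {N j : ℕ} (hfg : ∀ i < N, f i = g i) (hj : Live (f j)) (hkj : k < j)
    (hjN : j < N) (hn : n < N) : kill f k b n = kill g k b n := by
  have hclash : Clash f k ↔ Clash g k :=
    ⟨fun h => h.of_eqOn hfg hj hkj hjN,
      fun h => h.of_eqOn (fun i hi => (hfg i hi).symm) (by rwa [← hfg j hjN]) hkj hjN⟩
  have hrepair : repair f k b = repair g k b := by
    classical exact if_congr hclash (congrArg (turn · b) (hfg k (hkj.trans hjN))) rfl
  simp only [kill, hrepair, hfg n hn, hfg k (hkj.trans hjN)]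

/-- Otherwise the labels of two consecutive live numbers would eventually agree. -/
theorem Good.exists_infinite (hf : Good f) (hlive : {n | Live (f n)}.Infinite) :
    ∃ i, ∀ b, {n | Live (f n) ∧ f n i = b}.Infinite := by
  by_contra! hfin
  choose b hb using hfin
  have hev : ∀ᶠ n in Filter.atTop, Live (f n) → f n = fun i => !b i := by
    rw [← Nat.cofinite_eq_atTop]
    filter_upwards [Filter.eventually_all.2 fun i => (hb i).eventually_cofinite_notMem]
      with n hn hn_live
    exact funext fun i => Bool.eq_not.2 fun h => hn i ⟨hn_live, h⟩
  obtain ⟨N, hN⟩ := Filter.eventually_atTop.1 hev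
  obtain ⟨m, hm, hNm⟩ := hlive.exists_gt N
  have hex : ∃ n, Live (f n) ∧ m < n := hlive.exists_gt m
  obtain ⟨hn, hmn⟩ := Nat.find_spec hex
  have hcons : Consecutive f m (Nat.find hex) :=
    ⟨hmn, hm, hn, fun j hj hlive => Nat.find_min hex hj.2 ⟨hlive, hj.1⟩⟩
  exact (hf hcons).1 ((hN _ (hNm.trans hmn).le hn).trans (hN m hNm.le hm).symm)

end Kill

section Stage

open Filter

/-- The labelling after `s` stages, when the event `ev s = some (k, b)` stands for the enumeration
of `k` into `A` (`b = true`) or into `B` (`b = false`) at stage `s`. -/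
noncomputable def stage (ev : ℕ → Option (ℕ × Bool)) : ℕ → Labelling
  | 0 => fun n => bif n.bodd then ![true, false, true, false] else ![true, true, false, false]
  | s + 1 => (ev s).elim (stage ev s) fun e => kill (stage ev s) e.1 e.2

/-- No number is enumerated into both sets. -/
def Consistent (ev : ℕ → Option (ℕ × Bool)) : Prop :=
  ∀ s t n b c, ev s = some (n, b) → ev t = some (n, c) → b = c

/-- The label of every number is eventually the one given by `x`. -/
def IsLimit (ev : ℕ → Option (ℕ × Bool)) (x : Labelling) : Prop :=
  ∀ n, ∀ᶠ s in atTop, stage ev s n = x n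

variable {ev : ℕ → Option (ℕ × Bool)} {s t k n : ℕ} {b : Bool}

theorem stage_succ_of_none (h : ev s = none) : stage ev (s + 1) = stage ev s := by
  simp [stage, h]

theorem stage_succ_of_some (h : ev s = some (k, b)) :
    stage ev (s + 1) = kill (stage ev s) k b := by
  simp [stage, h]

theorem live_stage_zero (n : ℕ) : Live (stage ev 0 n) := by
  unfold stage
  cases n.bodd <;> simp only [cond_true, cond_false] <;> decide

theorem good_stage_zero : Good (stage ev 0) := by
  intro m n hmn
  have hn : n = m + 1 := by
    by_contra hne
    exact hmn.not_live_of_mem_Ioo (m + 1) ⟨m.lt_succ_self, lt_of_le_of_ne hmn.lt (Ne.symm hne)⟩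
      (live_stage_zero _)
  subst hn
  simp only [stage, Nat.bodd_succ]
  cases m.bodd <;> decide

theorem good_stage (s : ℕ) : Good (stage ev s) := by
  induction s with
  | zero => exact good_stage_zero
  | succ s ih =>
    cases h : ev s with
    | none => rwa [stage_succ_of_none h]
    | some e => exact stage_succ_of_some h ▸ ih.kill e.1 e.2

theorem live_stage_succ_iff :
    Live (stage ev (s + 1) n) ↔ (∀ b, ev s ≠ some (n, b)) ∧ Live (stage ev s n) := by
  cases h : ev s with
  | none => simp [stage_succ_of_none h]
  | some e =>
    obtain ⟨k, b⟩ := e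
    rw [stage_succ_of_some h, live_kill_iff]
    simp [eq_comm]

theorem live_stage_iff : Live (stage ev s n) ↔ ∀ t < s, ∀ b, ev t ≠ some (n, b) := by
  induction s with
  | zero => simp [live_stage_zero]
  | succ s ih => rw [live_stage_succ_iff, ih, Nat.forall_lt_succ_right, and_comm]

theorem stage_succ_eq_const (h : stage ev s n = fun _ => b) : stage ev (s + 1) n = fun _ => b := by
  cases hev : ev s with
  | none => rwa [stage_succ_of_none hev]
  | some e => rw [stage_succ_of_some hev, kill_eq_const h]

theorem stage_eq_const_of_not_live (huniq : Consistent ev) (ht : ev t = some (n, b))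
    (hs : ¬ Live (stage ev s n)) : stage ev s n = fun _ => b := by
  induction s with
  | zero => exact absurd (live_stage_zero n) hs
  | succ s ih =>
    by_cases hlive : Live (stage ev s n)
    · obtain ⟨c, hc⟩ : ∃ c, ev s = some (n, c) := by
        by_contra! hne
        exact hs (live_stage_succ_iff.2 ⟨hne, hlive⟩)
      rw [stage_succ_of_some hc, kill_self hlive, huniq s t n c b hc ht]
    · exact stage_succ_eq_const (ih hlive)

theorem stage_eq_const (huniq : Consistent ev) (ht : ev t = some (n, b)) (hts : t < s) :
    stage ev s n = fun _ => b :=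
  stage_eq_const_of_not_live huniq ht fun hlive => live_stage_iff.1 hlive t hts b ht

theorem of_stage_succ_apply_ne {i : Fin 4} (h : stage ev (s + 1) n i ≠ stage ev s n i) :
    ∃ k ≤ n, ∃ b, ev s = some (k, b) ∧ Live (stage ev s k) ∧ stage ev s k i ≠ b := by
  cases hev : ev s with
  | none => exact absurd (by rw [stage_succ_of_none hev]) h
  | some e =>
    rw [stage_succ_of_some hev] at h
    obtain ⟨hkn, hlive, hne⟩ := of_kill_apply_ne h
    exact ⟨e.1, hkn, e.2, rfl, hlive, hne⟩

theorem eventually_not_live (ev : ℕ → Option (ℕ × Bool)) (k : ℕ) :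
    ∀ᶠ s in atTop, ∀ b, ev s = some (k, b) → ¬ Live (stage ev s k) := by
  by_cases hk : ∃ t b, ev t = some (k, b)
  · obtain ⟨t, b, ht⟩ := hk
    filter_upwards [eventually_gt_atTop t] with s hts _ _ hlive
    exact live_stage_iff.1 hlive t hts b ht
  · exact .of_forall fun s b hs => absurd ⟨s, b, hs⟩ hk

theorem exists_isLimit (ev : ℕ → Option (ℕ × Bool)) : ∃ x, IsLimit ev x := by
  suffices ∀ n, ∃ v, ∀ᶠ s in atTop, stage ev s n = v from Classical.skolem.1 this
  intro n
  obtain ⟨N, hN⟩ := eventually_atTop.1 <| (eventually_all_finite (Set.finite_le_nat n)).2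
    fun k _ => eventually_not_live ev k
  refine ⟨stage ev N n, eventually_atTop.2 ⟨N, fun s hs => ?_⟩⟩
  induction s, hs using Nat.le_induction with
  | base => rfl
  | succ s hs ih =>
    rw [← ih]
    funext i
    by_contra hne
    obtain ⟨k, hkn, b, hev, hlive, -⟩ := of_stage_succ_apply_ne hne
    exact hN s hs k hkn b hev hlive

variable {x : Labelling}

theorem IsLimit.live_iff (hx : IsLimit ev x) : Live (x n) ↔ ∀ t b, ev t ≠ some (n, b) := by
  refine ⟨fun hlive t b ht => ?_, fun h => ?_⟩
  · obtain ⟨s, hs, hts⟩ := ((hx n).and (eventually_gt_atTop t)).exists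
    exact live_stage_iff.1 (hs ▸ hlive) t hts b ht
  · obtain ⟨s, hs⟩ := (hx n).exists
    exact hs ▸ live_stage_iff.2 fun t _ b => h t b

theorem IsLimit.eq_const (hx : IsLimit ev x) (huniq : Consistent ev) (ht : ev t = some (n, b)) :
    x n = fun _ => b := by
  obtain ⟨s, hs, hts⟩ := ((hx n).and (eventually_gt_atTop t)).exists
  exact hs ▸ stage_eq_const huniq ht hts

theorem IsLimit.good (hx : IsLimit ev x) : Good x := by
  intro m n h
  obtain ⟨s, hs⟩ :=
    ((eventually_all_finite (Set.finite_le_nat n)).2 fun k _ => hx k).exists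
  rw [← hs m h.lt.le, ← hs n (le_refl n)]
  refine good_stage s ⟨h.lt, hs m h.lt.le ▸ h.live_left, hs n (le_refl n) ▸ h.live_right,
    fun j hj => hs j hj.2.le ▸ h.not_live_of_mem_Ioo j hj⟩

/-- A change at `n` is caused by the enumeration of some `k ≤ n` whose label was wrong at `i`. -/
theorem IsLimit.stage_succ_apply_eq (hx : IsLimit ev x) (huniq : Consistent ev) {i : Fin 4}
    (hs : ∀ k ≤ n, stage ev s k i = x k i) : stage ev (s + 1) n i = x n i := by
  rw [← hs n le_rfl]
  by_contra hne
  obtain ⟨k, hkn, b, hev, -, hkb⟩ := of_stage_succ_apply_ne hne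
  exact hkb ((hs k hkn).trans (congrFun (hx.eq_const huniq hev) i))

end Stage

section StageComputability

/-- The labelling with the initial segment `ℓ` and no live position beyond it. Finite initial
segments carry the computation of the stages, since whole labellings cannot be encoded. -/
def ofList (ℓ : List Label) : Labelling := fun n => ℓ.getD n fun _ => false

variable {f : Labelling} {ℓ : List Label} {k n N : ℕ} {b : Bool}

theorem ofList_map_range (hn : n < N) : ofList ((List.range N).map f) n = f n := by
  simp [ofList, List.getD_eq_getElem?_getD, hn]

theorem lt_length_of_live_ofList (h : Live (ofList ℓ n)) : n < ℓ.length := by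
  by_contra hn
  rw [ofList, List.getD_eq_default _ _ (not_lt.1 hn)] at h
  exact not_live_const false h

theorem primrec_ofList : Primrec₂ ofList := Primrec.list_getD _

theorem primrecPred_live : PrimrecPred Live := ⟨inferInstance, .dom_finite _⟩

theorem primrecRel_compat : PrimrecRel Compat := ⟨fun _ => inferInstance, .dom_finite _⟩

theorem clash_ofList_iff : Clash (ofList ℓ) k ↔ ∃ m < ℓ.length, ∃ n < ℓ.length,
    (m < k ∧ k < n) ∧ Live (ofList ℓ m) ∧ Live (ofList ℓ n) ∧
      (¬ ∃ j < ℓ.length, (m < j ∧ j < n) ∧ Live (ofList ℓ j) ∧ j ≠ k) ∧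
        ¬ Compat (ofList ℓ m) (ofList ℓ n) := by
  constructor
  · rintro ⟨m, n, ⟨hk, hm, hn, hbetween⟩, hincompat⟩
    refine ⟨m, lt_length_of_live_ofList hm, n, lt_length_of_live_ofList hn, hk, hm, hn, ?_,
      hincompat⟩
    rintro ⟨j, -, hj, hlive, hjk⟩
    exact hjk (hbetween j hj hlive)
  · rintro ⟨m, -, n, -, hk, hm, hn, hbetween, hincompat⟩
    refine ⟨m, n, ⟨hk, hm, hn, fun j hj hlive => ?_⟩, hincompat⟩
    by_contra hjk
    exact hbetween ⟨j, lt_length_of_live_ofList hlive, hj, hlive, hjk⟩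

theorem primrecRel_clash_ofList : PrimrecRel fun ℓ k => Clash (ofList ℓ) k := by
  have hlive {α : Type} [Primcodable α] {ℓ : α → List Label} {j : α → ℕ} (hℓ : Primrec ℓ)
      (hj : Primrec j) : PrimrecPred fun a => Live (ofList (ℓ a) (j a)) :=
    primrecPred_live.comp (primrec_ofList.comp hℓ hj)
  have hℓ : Primrec fun q : ((List Label × ℕ) × ℕ) × ℕ => q.1.1.1 := .comp .fst (.comp .fst .fst)
  have hk : Primrec fun q : ((List Label × ℕ) × ℕ) × ℕ => q.1.1.2 := .comp .snd (.comp .fst .fst)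
  have hm : Primrec fun q : ((List Label × ℕ) × ℕ) × ℕ => q.1.2 := .comp .snd .fst
  have hn : Primrec fun q : ((List Label × ℕ) × ℕ) × ℕ => q.2 := .snd
  have hbetween : PrimrecPred fun q : ((List Label × ℕ) × ℕ) × ℕ => ∃ j < q.1.1.1.length,
      (q.1.2 < j ∧ j < q.2) ∧ Live (ofList q.1.1.1 j) ∧ j ≠ q.1.1.2 :=
    primrecPred_exists_lt (((Primrec.nat_lt.comp (hm.comp .fst) .snd).and
      (Primrec.nat_lt.comp .snd (hn.comp .fst))).and
        ((hlive (hℓ.comp .fst) .snd).and (Primrec.eq.comp .snd (hk.comp .fst)).not))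
      (Primrec.list_length.comp hℓ)
  have hstraddles := ((Primrec.nat_lt.comp hm hk).and (Primrec.nat_lt.comp hk hn)).and <|
    (hlive hℓ hm).and <| (hlive hℓ hn).and <| hbetween.not.and
      (primrecRel_compat.comp (primrec_ofList.comp hℓ hm) (primrec_ofList.comp hℓ hn)).not
  have hclash := primrecPred_exists_lt
    (primrecPred_exists_lt hstraddles.primrecRel (.comp .list_length (.comp .fst .fst))).primrecRel
    (.comp .list_length .fst)
  exact hclash.of_eq fun q => (clash_ofList_iff (ℓ := q.1) (k := q.2)).symm

/-- The effect of `kill` on an initial segment that determines whether there is a clash. -/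
noncomputable def killList (ℓ : List Label) (k : ℕ) (b : Bool) : List Label :=
  (List.range ℓ.length).map (kill (ofList ℓ) k b)

theorem killList_map_range {j : ℕ} (hj : Live (f j)) (hkj : k < j) (hjN : j < N) :
    killList ((List.range N).map f) k b = (List.range N).map (kill f k b) := by
  rw [killList, List.length_map, List.length_range]
  refine List.map_congr_left fun n hn => ?_
  have hof (i) (hi : i < N) : f i = ofList ((List.range N).map f) i := (ofList_map_range hi).symm
  exact (kill_congr hof hj hkj hjN (List.mem_range.1 hn)).symm

theorem primrec_repair_ofList : Primrec fun q : (List Label × ℕ × Bool) × ℕ =>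
    ofList q.1.1 q.2 ∘ repair (ofList q.1.1) q.1.2.1 q.1.2.2 := by
  classical
  have hℓ : Primrec fun q : (List Label × ℕ × Bool) × ℕ => q.1.1 := .comp .fst .fst
  have hk : Primrec fun q : (List Label × ℕ × Bool) × ℕ => q.1.2.1 :=
    .comp .fst (.comp .snd .fst)
  have hb : Primrec fun q : (List Label × ℕ × Bool) × ℕ => q.1.2.2 :=
    .comp .snd (.comp .snd .fst)
  have hturn : Primrec fun q : Label × Label × Bool => q.1 ∘ turn q.2.1 q.2.2 := .dom_finite _
  have hv : Primrec fun q : (List Label × ℕ × Bool) × ℕ => ofList q.1.1 q.2 :=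
    primrec_ofList.comp hℓ .snd
  have hite := Primrec.ite (primrecRel_clash_ofList.comp hℓ hk)
    (hturn.comp (hv.pair ((primrec_ofList.comp hℓ hk).pair hb))) hv
  refine hite.of_eq fun q => ?_
  by_cases h : Clash (ofList q.1.1) q.1.2.1 <;> simp [repair, h]

theorem primrec_kill_ofList : Primrec fun q : (List Label × ℕ × Bool) × ℕ =>
    kill (ofList q.1.1) q.1.2.1 q.1.2.2 q.2 := by
  have hℓ : Primrec fun q : (List Label × ℕ × Bool) × ℕ => q.1.1 := .comp .fst .fst
  have hk : Primrec fun q : (List Label × ℕ × Bool) × ℕ => q.1.2.1 :=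
    .comp .fst (.comp .snd .fst)
  have hb : Primrec fun q : (List Label × ℕ × Bool) × ℕ => q.1.2.2 :=
    .comp .snd (.comp .snd .fst)
  have hconst : Primrec fun (b : Bool) (_ : Fin 4) => b := .dom_finite _
  exact .ite ((Primrec.nat_lt.comp .snd hk).or
      (primrecPred_live.comp (primrec_ofList.comp hℓ hk)).not) (primrec_ofList.comp hℓ .snd) <|
    .ite (Primrec.eq.comp .snd hk) (hconst.comp hb) primrec_repair_ofList

theorem primrec_killList : Primrec fun q : List Label × ℕ × Bool => killList q.1 q.2.1 q.2.2 :=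
  .list_map (.comp .list_range (.comp .list_length .fst)) primrec_kill_ofList.to₂

variable {ev : ℕ → Option (ℕ × Bool)}

/-- The labels of the numbers below `N` after `s` stages, computed from those labels alone; this is
accurate while a number below `N` that lies beyond all enumerated ones is still live. -/
noncomputable def stageList (ev : ℕ → Option (ℕ × Bool)) (N : ℕ) : ℕ → List Label
  | 0 => (List.range N).map (stage ev 0)
  | s + 1 => (ev s).elim (stageList ev N s) fun e => killList (stageList ev N s) e.1 e.2

theorem stageList_eq (hle : ∀ s k b, ev s = some (k, b) → k ≤ s) {s : ℕ} (hs : s < N) :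
    stageList ev N s = (List.range N).map (stage ev s) := by
  induction s with
  | zero => rfl
  | succ s ih =>
    rw [stageList, ih (s.lt_succ_self.trans hs)]
    cases h : ev s with
    | none => rw [stage_succ_of_none h, Option.elim_none]
    | some e =>
      have hlive : Live (stage ev s (s + 1)) :=
        live_stage_iff.2 fun t ht b hb => by linarith [hle t _ b hb]
      rw [stage_succ_of_some h, Option.elim_some,
        killList_map_range hlive (Nat.lt_succ_of_le (hle s _ _ h)) hs]

theorem primrec_stageList (hev : Primrec ev) : Primrec₂ (stageList ev) := by
  have hlabel : Primrec (stage ev 0) :=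
    (Primrec.dom_finite fun b : Bool => bif b then ![true, false, true, false] else
      (![true, true, false, false] : Label)).comp .nat_bodd
  have hzero : Primrec fun N => (List.range N).map (stage ev 0) :=
    .list_map .list_range (hlabel.comp .snd).to₂
  have hℓ : Primrec fun q : ℕ × ℕ × List Label => q.2.2 := .comp .snd .snd
  have hsucc : Primrec₂ fun (_ : ℕ) (q : ℕ × List Label) =>
      (ev q.1).elim q.2 fun e => killList q.2 e.1 e.2 :=
    (Primrec.option_casesOn (.comp hev (.comp .fst .snd)) hℓ
      (primrec_killList.comp ((hℓ.comp .fst).pair .snd)).to₂).of_eq fun q => by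
        cases h : ev q.2.1 <;> simp [h]
  refine (Primrec.nat_rec hzero hsucc).of_eq fun N s => ?_
  induction s with
  | zero => rfl
  | succ s ih => simp only [ih, stageList]

theorem primrec_stage (hev : Primrec ev) (hle : ∀ s k b, ev s = some (k, b) → k ≤ s) :
    Primrec₂ fun s n => stage ev s n := by
  have hbound : Primrec fun q : ℕ × ℕ => q.1 + q.2 + 1 := Primrec.succ.comp .nat_add
  refine (primrec_ofList.comp ((primrec_stageList hev).comp hbound .fst) .snd).of_eq
    fun ⟨s, n⟩ => ?_
  rw [stageList_eq hle (by omega), ofList_map_range (by omega)]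

end StageComputability

theorem exists_consistent_enumeration {A B : Set ℕ} (hA : IsCE A) (hB : IsCE B)
    (hAB : Disjoint A B) :
    ∃ ev, Primrec ev ∧ (∀ s k b, ev s = some (k, b) → k ≤ s) ∧ Consistent ev ∧
      (∀ n, n ∈ A ↔ ∃ s, ev s = some (n, true)) ∧ ∀ n, n ∈ B ↔ ∃ s, ev s = some (n, false) := by
  obtain ⟨ev, hev, hle, hmem⟩ := exists_primrec_enumeration (rePred_cond_mem hA hB)
  have hmemA (n : ℕ) : n ∈ A ↔ ∃ s, ev s = some (n, true) := hmem (n, true)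
  have hmemB (n : ℕ) : n ∈ B ↔ ∃ s, ev s = some (n, false) := hmem (n, false)
  refine ⟨ev, hev, fun s k b h => (Nat.left_le_pair k _).trans (hle s _ h), ?_, hmemA, hmemB⟩
  have hnot (n s t : ℕ) (hs : ev s = some (n, true)) (ht : ev t = some (n, false)) : False :=
    Set.disjoint_left.1 hAB ((hmemA n).2 ⟨s, hs⟩) ((hmemB n).2 ⟨t, ht⟩)
  rintro s t n (_ | _) (_ | _) hs ht
  · rfl
  · exact (hnot n t s ht hs).elim
  · exact (hnot n s t hs ht).elim
  · rfl

theorem IsLimit.hasCEDegree {ev : ℕ → Option (ℕ × Bool)} {x : Labelling} (hx : IsLimit ev x)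
    (hev : Primrec ev) (hle : ∀ s k b, ev s = some (k, b) → k ≤ s) (huniq : Consistent ev)
    (i : Fin 4) : HasCEDegree {n | x n i = true} := by
  have hcomp : Computable₂ fun s n => stage ev s n i :=
    (Primrec.dom_finite fun v : Label => v i).to_comp.comp (primrec_stage hev hle).to_comp
  refine hasCEDegree_of_approx hcomp (fun n => ?_) fun s n hs => ?_
  · filter_upwards [hx n] with s hs
    simp [hs]
  · simpa using hx.stage_succ_apply_eq huniq (by simpa using hs)

end Labelling

theorem not_eqStar_of_infinite_diff {X Y : Set ℕ} (h : (X \ Y).Infinite) : ¬ EqStar X Y :=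
  fun hfin => h (hfin.subset Set.subset_union_left)

open Label Labelling in
theorem exists_separator {A B : Set ℕ} (hA : IsCE A) (hB : IsCE B) (hAB : Disjoint A B)
    (hinf : (A ∪ B)ᶜ.Infinite) :
    ∃ X : Set ℕ, IsSeparator A B X ∧ HasCEDegree X ∧ ¬ EqStar X A ∧ ¬ EqStar Xᶜ B := by
  obtain ⟨ev, hev, hle, huniq, hmemA, hmemB⟩ := exists_consistent_enumeration hA hB hAB
  obtain ⟨x, hx⟩ := exists_isLimit ev
  have hlive (n : ℕ) : Live (x n) ↔ n ∉ A ∧ n ∉ B := by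
    rw [hx.live_iff, hmemA, hmemB]
    simp only [Bool.forall_bool, not_exists, forall_and, and_comm, ne_eq]
  have hlive_inf : {n | Live (x n)}.Infinite := hinf.mono fun n hn => by simpa [hlive] using hn
  obtain ⟨i, hi⟩ := hx.good.exists_infinite hlive_inf
  have hsep : IsSeparator A B {n | x n i = true} := by
    refine ⟨fun n hn => ?_, fun n hn => ?_⟩
    · obtain ⟨s, hs⟩ := (hmemA n).1 hn
      simp [hx.eq_const huniq hs]
    · obtain ⟨s, hs⟩ := (hmemB n).1 hn
      simp [hx.eq_const huniq hs]
  refine ⟨{n | x n i = true}, hsep, hx.hasCEDegree hev hle huniq i,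
    not_eqStar_of_infinite_diff ((hi true).mono fun n hn => ?_),
    not_eqStar_of_infinite_diff ((hi false).mono fun n hn => ?_)⟩
  · exact ⟨hn.2, ((hlive n).1 hn.1).1⟩
  · exact ⟨by simp [hn.2], ((hlive n).1 hn.1).2⟩

theorem mainTheorem1 :
    (∀ A B : Set ℕ, IsCE A → IsCE B → A ∩ B = ∅ → (A ∪ B)ᶜ.Infinite →
      ∃ X : Set ℕ, IsSeparator A B X ∧ HasCEDegree X ∧ ¬ EqStar X A ∧ ¬ EqStar Xᶜ B) ∧
    ¬ ∃ A B : Set ℕ, IsSuperMaximalPair A B := by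
  have hexists {A B : Set ℕ} (hA : IsCE A) (hB : IsCE B) (hAB : A ∩ B = ∅) :=
    exists_separator hA hB (Set.disjoint_iff_inter_eq_empty.2 hAB)
  refine ⟨fun A B => hexists, ?_⟩
  rintro ⟨A, B, h⟩
  obtain ⟨X, hsep, hdeg, hXA, hXB⟩ :=
    hexists h.ce_left h.ce_right h.disjoint h.infinite_compl
  exact (h.eqStar_of_separator X hdeg hsep).elim hXA hXB
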